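/- Let $n \ge 2$. Let $f_n(x)=x_1^2+\cdots+x_n^2-x_{n+1}^2$ on $\mathbb R^{n+1}$, let $H^n=\{x\in\mathbb R^{n+1} : f_n(x)=-1,\ x_{n+1}>0\}$ be hyperbolic $n$-space, and let $\mathrm{SO}^+(n,1)$ be the group of real $(n+1)\times(n+1)$ matrices of determinant $1$ that preserve $f_n$ and leave $H^n$ invariant (the group of orientation-preserving isometries of $H^n$). Let $\mathrm{C}\ell(n,1)$ be the real Clifford algebra generated by $\mathbb R^{n+1}$ with relations $v^2=-f_n(v)1$, let $\mathrm{Spin}(n,1)$ be the group of products $v_1\cdots v_k$ in it with $k$ even and each $v_i\in\mathbb R^{n+1}$ satisfying $f_n(v_i)=\pm1$, and let $\mathrm{Spin}^+(n,1)$ be its identity component. Let $\eta:\mathrm{Spin}^+(n,1)\to\mathrm{SO}^+(n,1)$, $\eta(x)w=xwx^{-1}$, be the double covering epimorphism. Let $\Gamma$ be a torsion-free discrete subgroup of $\mathrm{SO}^+(n,1)$, let $\varphi$ be an orientation-preserving isometry of the hyperbolic space-form $\Gamma\backslash H^n$, and let $f\in\mathrm{SO}^+(n,1)$ be such that $f\Gamma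 f^{-1}=\Gamma$ and $\varphi=\overline f$, where $\overline f(\Gamma x)=\Gamma fx$. Let $\varphi_\star$ be the induced self-diffeomorphism $\varphi_\star(\Gamma g)=\Gamma fg$ of the oriented orthonormal frame bundle $\Gamma\backslash\mathrm{SO}^+(n,1)$ of $\Gamma\backslash H^n$; it depends only on $\varphi$, since $f$ is unique up to left multiplication by elements of $\Gamma$. Let $\hat\Gamma$ be a subgroup of $\mathrm{Spin}^+(n,1)$ that $\eta$ maps isomorphically onto $\Gamma$, let $\rho:\hat\Gamma\backslash\mathrm{Spin}^+(n,1)\to\Gamma\backslash\mathrm{SO}^+(n,1)$, $\rho(\hat\Gamma g)=\Gamma\eta(g)$, be the spin structure on $\Gamma\backslash H^n$ induced by $\eta$, and let $\hat f\in\mathrm{Spin}^+(n,1)$ be such that $\eta(\hat f)=f$. Then $\varphi$ lifts to the spin structure $\rho$, that is, there is a self-diffeomorphism $\hat\varphi_\star$ of $\hat\Gamma\backslash\mathrm{Spin}^+(n,1)$ with $\rho\hat\varphi_\star=\varphi_\star\rho$, if and only if $\hat f\hat\Gamma\hat f^{-1}=\hat\Gamma$. -/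

import Mathlib

open scoped Topology ContDiff

noncomputable section

namespace HypSpin

/-! ### Lorentzian space, hyperbolic space and the Lorentz groups -/

/-- The Lorentzian quadratic form `x₁² + ⋯ + xₙ² - xₙ₊₁²` on `ℝⁿ⁺¹`. -/
def lorentz (n : ℕ) : QuadraticForm ℝ (Fin (n + 1) → ℝ) :=
  QuadraticMap.weightedSumSquares ℝ (fun i : Fin (n + 1) => if i = Fin.last n then (-1 : ℝ) else 1)

theorem lorentz_apply (n : ℕ) (x : Fin (n + 1) → ℝ) :
    lorentz n x = ∑ i : Fin n, x i.castSucc ^ 2 - x (Fin.last n) ^ 2 := by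
  simp [lorentz, QuadraticMap.weightedSumSquares_apply, Fin.sum_univ_castSucc, pow_two,
    (Fin.castSucc_lt_last _).ne, sub_eq_add_neg]

/-- The hyperboloid `{x : f_n(x) = -1, xₙ₊₁ > 0}` as a subset of `ℝⁿ⁺¹`. -/
def hyperboloid (n : ℕ) : Set (Fin (n + 1) → ℝ) :=
  {x | lorentz n x = -1 ∧ 0 < x (Fin.last n)}

/-- Hyperbolic `n`-space `Hⁿ` (hyperboloid model). -/
abbrev HSpace (n : ℕ) : Type := hyperboloid n

/-- The orthogonal group `O(n,1)` of the Lorentzian form. -/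
def OGroup (n : ℕ) : Subgroup (GL (Fin (n + 1)) ℝ) where
  carrier := {A | ∀ x, lorentz n (A.1.mulVec x) = lorentz n x}
  mul_mem' {A B} hA hB x := by
    rw [Units.val_mul, ← Matrix.mulVec_mulVec, hA, hB]
  one_mem' x := by simp
  inv_mem' {A} hA x := by
    rw [← hA, Matrix.mulVec_mulVec, ← Units.val_mul, mul_inv_cancel, Units.val_one,
      Matrix.one_mulVec]

/-- `O⁺(n,1)`: the elements of `O(n,1)` that leave `Hⁿ` invariant. -/
def OPlus (n : ℕ) : Subgroup (GL (Fin (n + 1)) ℝ) where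
  carrier := {A | A ∈ OGroup n ∧ A.1.mulVec '' hyperboloid n = hyperboloid n}
  mul_mem' {A B} hA hB := by
    refine ⟨mul_mem hA.1 hB.1, ?_⟩
    have : (A * B).1.mulVec = A.1.mulVec ∘ B.1.mulVec := by
      funext x; simp [Matrix.mulVec_mulVec]
    rw [this, Set.image_comp, hB.2, hA.2]
  one_mem' := ⟨one_mem _, by simp⟩
  inv_mem' {A} hA := by
    refine ⟨inv_mem hA.1, ?_⟩
    have : (A⁻¹).1.mulVec ∘ A.1.mulVec = id := by
      funext x
      rw [Function.comp_apply, Matrix.mulVec_mulVec, ← Units.val_mul, inv_mul_cancel,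
        Units.val_one, Matrix.one_mulVec, id]
    conv_lhs => rw [← hA.2]
    rw [← Set.image_comp, this, Set.image_id]

/-- `SO⁺(n,1)`: the elements of `O⁺(n,1)` of determinant `1`, with the topology induced from
`GL(n+1, ℝ)`. -/
def SOPlus (n : ℕ) : Subgroup (GL (Fin (n + 1)) ℝ) where
  carrier := {A | A ∈ OPlus n ∧ A.1.det = 1}
  mul_mem' {A B} hA hB := ⟨mul_mem hA.1 hB.1, by
    rw [Units.val_mul, Matrix.det_mul, hA.2, hB.2, one_mul]⟩
  one_mem' := ⟨one_mem _, by simp⟩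
  inv_mem' {A} hA := ⟨inv_mem hA.1, by
    have h : A.1.det * (A⁻¹).1.det = 1 := by
      rw [← Matrix.det_mul, ← Units.val_mul, mul_inv_cancel, Units.val_one, Matrix.det_one]
    rwa [hA.2, one_mul] at h⟩

theorem SOPlus.mulVec_mem {n : ℕ} (A : SOPlus n) (x : HSpace n) :
    A.1.1.mulVec x.1 ∈ hyperboloid n := by
  have h := Set.mem_image_of_mem A.1.1.mulVec x.2
  rwa [A.2.1.2] at h

/-- The action of `SO⁺(n,1)` on `Hⁿ` by matrix multiplication. -/
instance (n : ℕ) : MulAction (SOPlus n) (HSpace n) where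
  smul A x := ⟨A.1.1.mulVec x.1, SOPlus.mulVec_mem A x⟩
  one_smul x := Subtype.ext (by
    change (1 : Matrix (Fin (n + 1)) (Fin (n + 1)) ℝ).mulVec x.1 = x.1
    simp)
  mul_smul A B x := Subtype.ext (by
    change (A.1.1 * B.1.1).mulVec x.1 = A.1.1.mulVec (B.1.1.mulVec x.1)
    rw [Matrix.mulVec_mulVec])

/-! ### Orbit spaces -/

/-- The orbit space `Γ\X` for a subgroup `Γ` of a group `G` acting on the left of `X`. For
`X = G` (acting on itself by left multiplication) its points are the cosets `Γg`. -/
abbrev OrbitSpace {G : Type*} [Group G] (Γ : Subgroup G) (X : Type*) [MulAction G X] : Type _ :=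
  MulAction.orbitRel.Quotient Γ X

/-- The orbit `Γx` as a point of `Γ\X`. -/
def orbitMk {G X : Type*} [Group G] [MulAction G X] (Γ : Subgroup G) (x : X) : OrbitSpace Γ X :=
  Quotient.mk _ x

/-- The conjugate subgroup `g K g⁻¹`. -/
def conjSubgroup {G : Type*} [Group G] (g : G) (K : Subgroup G) : Subgroup G :=
  K.map (MulAut.conj g).toMonoidHom

/-- If `f Γ f⁻¹ = Γ`, the induced map `Γ\X → Γ\X`, `Γx ↦ Γfx`. -/
def inducedMap {G : Type*} [Group G] (Γ : Subgroup G) (X : Type*) [MulAction G X] (f : G)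
    (hf : conjSubgroup f Γ = Γ) : OrbitSpace Γ X → OrbitSpace Γ X :=
  Quotient.lift (fun x => orbitMk Γ (f • x)) (by
    rintro _ y ⟨γ, rfl⟩
    refine Quotient.sound ⟨⟨f * γ.1 * f⁻¹, ?_⟩, ?_⟩
    · have h : f * γ.1 * f⁻¹ ∈ conjSubgroup f Γ := ⟨γ.1, γ.2, rfl⟩
      rwa [hf] at h
    · change (f * γ.1 * f⁻¹) • (f • y) = f • (γ.1 • y)
      simp [smul_smul])

/-! ### The Clifford algebra and the spin groups -/

/-- The Clifford algebra `Cℓ(n,1)`, generated by `ℝⁿ⁺¹` with the relations `v² = -f_n(v)`. -/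
abbrev Cl (n : ℕ) : Type := CliffordAlgebra (-lorentz n)

/-- The inclusion of `ℝⁿ⁺¹` in `Cℓ(n,1)`. -/
abbrev vec (n : ℕ) : (Fin (n + 1) → ℝ) →ₗ[ℝ] Cl n := CliffordAlgebra.ι (-lorentz n)

instance (n : ℕ) : Module.Finite ℝ (Cl n) :=
  have : Module.Finite ℝ (ExteriorAlgebra ℝ (Fin (n + 1) → ℝ)) :=
    Module.Finite.of_basis (Pi.basisFun ℝ (Fin (n + 1))).ExteriorAlgebra
  Module.Finite.equiv (CliffordAlgebra.equivExterior (-lorentz n)).symm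

/-- `Cℓ(n,1)` is a finite dimensional real vector space, so all its norms are equivalent and
induce the same topology and the same smooth functions; we use the sup norm of the coordinates with
respect to some basis. -/
instance (n : ℕ) : NormedAddCommGroup (Cl n) :=
  NormedAddCommGroup.induced (Cl n) (Fin (Module.finrank ℝ (Cl n)) → ℝ)
    (Module.finBasis ℝ (Cl n)).equivFun (Module.finBasis ℝ (Cl n)).equivFun.injective

instance (n : ℕ) : NormedSpace ℝ (Cl n) :=
  NormedSpace.induced ℝ (Cl n) (Fin (Module.finrank ℝ (Cl n)) → ℝ)
    (Module.finBasis ℝ (Cl n)).equivFun.toLinearMap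

instance (n : ℕ) : ContinuousMul (Cl n) :=
  ⟨(LinearMap.toContinuousLinearMap (LinearMap.toContinuousLinearMap.toLinearMap ∘ₗ
    LinearMap.mul ℝ (Cl n)) : Cl n →L[ℝ] Cl n →L[ℝ] Cl n).continuous₂⟩

theorem vec_injective (n : ℕ) : Function.Injective (vec n) := by
  intro v w h
  have h' := congrArg (CliffordAlgebra.equivExterior (-lorentz n)) h
  simp only [CliffordAlgebra.equivExterior, CliffordAlgebra.changeFormEquiv_apply,
    CliffordAlgebra.changeForm_ι] at h'
  exact ExteriorAlgebra.ι_leftInverse.injective h'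

theorem vec_mul_vec (n : ℕ) (v : Fin (n + 1) → ℝ) :
    vec n v * vec n v = algebraMap ℝ (Cl n) (-lorentz n v) :=
  CliffordAlgebra.ι_sq_scalar _ _

theorem vec_mul_neg_smul (n : ℕ) (v : Fin (n + 1) → ℝ)
    (hv : lorentz n v = 1 ∨ lorentz n v = -1) :
    vec n v * vec n (-(lorentz n v) • v) = 1 := by
  rw [map_smul, mul_smul_comm, vec_mul_vec, Algebra.algebraMap_eq_smul_one, smul_smul]
  rcases hv with h | h <;> simp [h]

theorem lorentz_neg_smul (n : ℕ) (v : Fin (n + 1) → ℝ)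
    (hv : lorentz n v = 1 ∨ lorentz n v = -1) :
    lorentz n (-(lorentz n v) • v) = lorentz n v := by
  rw [QuadraticMap.map_smul]
  rcases hv with h | h <;> simp [h]

theorem vecProd_mul_inv (n : ℕ) (l : List (Fin (n + 1) → ℝ))
    (hl : ∀ v ∈ l, lorentz n v = 1 ∨ lorentz n v = -1) :
    (l.map (vec n)).prod *
      ((l.map fun v => -(lorentz n v) • v).reverse.map (vec n)).prod = 1 := by
  induction l with
  | nil => simp
  | cons v l ih =>
    have ih' := ih fun w hw => hl w (List.mem_cons_of_mem _ hw)
    simp only [List.map_cons, List.prod_cons, List.reverse_cons, List.map_append, List.prod_append,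
      List.map_nil, List.prod_nil, mul_one]
    rw [mul_assoc, ← mul_assoc _ _ (vec n _), ih', one_mul]
    exact vec_mul_neg_smul n v (hl v List.mem_cons_self)

/-- `Spin(n,1)`: the group of all products `v₁ ⋯ v_k` in `Cℓ(n,1)` with `k` even and
`f_n(v_i) = ±1` for all `i`, with the topology induced from the group of units of `Cℓ(n,1)`. -/
def SpinGroup (n : ℕ) : Subgroup (Cl n)ˣ where
  carrier := {x | ∃ l : List (Fin (n + 1) → ℝ),
    (∀ v ∈ l, lorentz n v = 1 ∨ lorentz n v = -1) ∧ Even l.length ∧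
      (x : Cl n) = (l.map (vec n)).prod}
  mul_mem' := by
    rintro x y ⟨l, hl, hle, hx⟩ ⟨m, hm, hme, hy⟩
    refine ⟨l ++ m, ?_, ?_, ?_⟩
    · intro v hv
      rcases List.mem_append.1 hv with h | h
      exacts [hl v h, hm v h]
    · rw [List.length_append]
      exact hle.add hme
    · rw [Units.val_mul, hx, hy, List.map_append, List.prod_append]
  one_mem' := ⟨[], by simp, by simp, by simp⟩
  inv_mem' := by
    rintro x ⟨l, hl, hle, hx⟩
    refine ⟨(l.map fun v => -(lorentz n v) • v).reverse, ?_, by simpa using hle, ?_⟩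
    · intro v hv
      rw [List.mem_reverse, List.mem_map] at hv
      obtain ⟨w, hw, rfl⟩ := hv
      rw [lorentz_neg_smul n w (hl w hw)]
      exact hl w hw
    · rw [Units.inv_eq_of_mul_eq_one_right]
      rw [hx]
      exact vecProd_mul_inv n l hl

/-- `Spin⁺(n,1)`: the connected component of `Spin(n,1)` containing the identity. -/
def SpinPlus (n : ℕ) : Subgroup (SpinGroup n) :=
  Subgroup.connectedComponentOfOne (SpinGroup n)

/-- An element of `Spin⁺(n,1)` as an element of `Cℓ(n,1)`. -/
def toCl {n : ℕ} (x : SpinPlus n) : Cl n := ((x : SpinGroup n) : (Cl n)ˣ)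

/-! ### The double covering `η = Ad` -/

theorem conj_vec_mem (n : ℕ) (x : SpinGroup n) (w : Fin (n + 1) → ℝ) :
    (x.1 : Cl n) * vec n w * ((x.1⁻¹ : (Cl n)ˣ) : Cl n) ∈ LinearMap.range (vec n) := by
  obtain ⟨x, hx⟩ := x
  obtain ⟨l, hl, -, hx⟩ := hx
  change (x : Cl n) * vec n w * ((x⁻¹ : (Cl n)ˣ) : Cl n) ∈ LinearMap.range (vec n)
  have hinv : ((x⁻¹ : (Cl n)ˣ) : Cl n) =
      ((l.map fun v => -(lorentz n v) • v).reverse.map (vec n)).prod := by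
    rw [Units.inv_eq_of_mul_eq_one_right]
    rw [hx]
    exact vecProd_mul_inv n l hl
  rw [hx, hinv]
  clear * -
  induction l generalizing w with
  | nil => simp
  | cons v l ih =>
    obtain ⟨u, hu⟩ := ih w
    simp only [List.map_cons, List.prod_cons, List.reverse_cons, List.map_append, List.prod_append,
      List.map_nil, List.prod_nil, mul_one]
    refine ⟨-(lorentz n v) •
      (QuadraticMap.polar (-lorentz n) v u • v - (-lorentz n) v • u), ?_⟩
    rw [map_smul, ← CliffordAlgebra.ι_mul_ι_mul_ι, hu, map_smul]
    simp only [mul_assoc, mul_smul_comm]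

/-- The matrix of `Ad(x) : w ↦ x w x⁻¹` on `ℝⁿ⁺¹ ⊆ Cℓ(n,1)`. -/
def adMatrix (n : ℕ) (x : SpinGroup n) : Matrix (Fin (n + 1)) (Fin (n + 1)) ℝ :=
  LinearMap.toMatrix' ((vec n).leftInverse ∘ₗ
    LinearMap.mulLeft ℝ (x.1 : Cl n) ∘ₗ
      LinearMap.mulRight ℝ ((x.1⁻¹ : (Cl n)ˣ) : Cl n) ∘ₗ vec n)

theorem adMatrix_mulVec (n : ℕ) (x : SpinGroup n) (w : Fin (n + 1) → ℝ) :
    (adMatrix n x).mulVec w =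
      (vec n).leftInverse ((x.1 : Cl n) * vec n w * ((x.1⁻¹ : (Cl n)ˣ) : Cl n)) := by
  rw [adMatrix, LinearMap.toMatrix'_mulVec]
  simp [mul_assoc]

theorem vec_adMatrix (n : ℕ) (x : SpinGroup n) (w : Fin (n + 1) → ℝ) :
    vec n ((adMatrix n x).mulVec w) =
      (x.1 : Cl n) * vec n w * ((x.1⁻¹ : (Cl n)ˣ) : Cl n) := by
  obtain ⟨u, hu⟩ := conj_vec_mem n x w
  rw [adMatrix_mulVec, ← hu,
    LinearMap.leftInverse_apply_of_inj (LinearMap.ker_eq_bot.2 (vec_injective n))]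

theorem adMatrix_mul (n : ℕ) (x y : SpinGroup n) :
    adMatrix n (x * y) = adMatrix n x * adMatrix n y := by
  refine Matrix.toLin'.injective (LinearMap.ext fun w => vec_injective n ?_)
  rw [Matrix.toLin'_apply, Matrix.toLin'_apply, ← Matrix.mulVec_mulVec, vec_adMatrix,
    vec_adMatrix, vec_adMatrix]
  simp [mul_assoc]

theorem adMatrix_one (n : ℕ) : adMatrix n 1 = 1 := by
  refine Matrix.toLin'.injective (LinearMap.ext fun w => vec_injective n ?_)
  rw [Matrix.toLin'_apply, Matrix.toLin'_apply, vec_adMatrix]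
  simp

theorem lorentz_adMatrix (n : ℕ) (x : SpinGroup n) (w : Fin (n + 1) → ℝ) :
    lorentz n ((adMatrix n x).mulVec w) = lorentz n w := by
  have h : algebraMap ℝ (Cl n) (-lorentz n ((adMatrix n x).mulVec w)) =
      algebraMap ℝ (Cl n) (-lorentz n w) := by
    rw [← vec_mul_vec, vec_adMatrix]
    have : (x.1 : Cl n) * vec n w * ((x.1⁻¹ : (Cl n)ˣ) : Cl n) *
        ((x.1 : Cl n) * vec n w * ((x.1⁻¹ : (Cl n)ˣ) : Cl n)) =
        (x.1 : Cl n) * (vec n w * vec n w) * ((x.1⁻¹ : (Cl n)ˣ) : Cl n) := by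
      simp only [mul_assoc, Units.inv_mul_cancel_left]
    rw [this, vec_mul_vec, ← Algebra.commutes, mul_assoc, Units.mul_inv, mul_one]
  have h' := congrArg (CliffordAlgebra.equivExterior (-lorentz n)) h
  simp only [CliffordAlgebra.equivExterior, CliffordAlgebra.changeFormEquiv_apply,
    CliffordAlgebra.changeForm_algebraMap] at h'
  exact neg_injective ((ExteriorAlgebra.algebraMap_inj _ _ _).1 h')

theorem continuous_adMatrix (n : ℕ) : Continuous (adMatrix n) := by
  refine continuous_matrix fun i j => ?_
  have h : ∀ x : SpinGroup n, adMatrix n x i j =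
      (vec n).leftInverse ((x.1 : Cl n) * vec n (Pi.single j 1) *
        ((x.1⁻¹ : (Cl n)ˣ) : Cl n)) i := by
    intro x
    rw [← adMatrix_mulVec]
    simp
  simp only [h]
  have hc : Continuous ((vec n).leftInverse) := LinearMap.continuous_of_finiteDimensional _
  have h1 : Continuous fun x : SpinGroup n => (x.1 : Cl n) :=
    Units.continuous_val.comp continuous_subtype_val
  have h2 : Continuous fun x : SpinGroup n => ((x.1⁻¹ : (Cl n)ˣ) : Cl n) :=
    Units.continuous_val.comp (continuous_inv.comp continuous_subtype_val)
  exact (continuous_apply i).comp (hc.comp ((h1.mul continuous_const).mul h2))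

/-- A continuous nowhere vanishing real function on `Spin(n,1)` that is positive at `1` is positive
on `Spin⁺(n,1)`. -/
theorem pos_of_mem_spinPlus (n : ℕ) (F : SpinGroup n → ℝ) (hF : Continuous F)
    (h0 : ∀ x, F x ≠ 0) (h1 : 0 < F 1) (x : SpinGroup n) (hx : x ∈ SpinPlus n) : 0 < F x := by
  by_contra hneg
  have hpc : IsPreconnected (connectedComponent (1 : SpinGroup n)) :=
    isPreconnected_connectedComponent
  obtain ⟨y, -, hy⟩ := hpc.intermediate_value hx mem_connectedComponent hF.continuousOn
    (⟨not_lt.1 hneg, h1.le⟩ : (0 : ℝ) ∈ Set.Icc (F x) (F 1))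
  exact h0 y hy

theorem discr_lorentz_ne_zero (n : ℕ) : (lorentz n).discr' ≠ 0 := by
  have hd : (lorentz n).toMatrix' =
      Matrix.diagonal fun i : Fin (n + 1) => if i = Fin.last n then (-1 : ℝ) else 1 := by
    have hw : lorentz n = LinearMap.BilinMap.toQuadraticMap (Matrix.toLinearMap₂' ℝ
        (Matrix.diagonal fun i : Fin (n + 1) => if i = Fin.last n then (-1 : ℝ) else 1)) := by
      ext w
      rw [LinearMap.BilinMap.toQuadraticMap_apply, Matrix.toLinearMap₂'_apply', lorentz,
        QuadraticMap.weightedSumSquares_apply]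
      simp [dotProduct, Matrix.mulVec_diagonal, mul_left_comm]
    rw [hw, QuadraticForm.toMatrix', QuadraticMap.associated_left_inverse,
      LinearMap.toMatrix'_toLinearMap₂']
    intro x y
    simp [Matrix.toLinearMap₂'_apply', dotProduct, Matrix.mulVec_diagonal,
      mul_comm]
  rw [QuadraticForm.discr', hd, Matrix.det_diagonal, Finset.prod_ne_zero_iff]
  intro i _
  split_ifs <;> norm_num

theorem det_adMatrix_sq (n : ℕ) (x : SpinGroup n) :
    (adMatrix n x).det * (adMatrix n x).det = 1 := by
  have h := QuadraticForm.discr'_comp (Q := lorentz n) (Matrix.toLin' (adMatrix n x))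
  have h2 : (lorentz n).comp (Matrix.toLin' (adMatrix n x)) = lorentz n := by
    ext w
    simp [lorentz_adMatrix]
  rw [h2, LinearMap.toMatrix'_toLin'] at h
  exact mul_right_cancel₀ (discr_lorentz_ne_zero n) (by rw [one_mul]; exact h.symm)

theorem det_adMatrix (n : ℕ) (x : SpinGroup n) (hx : x ∈ SpinPlus n) :
    (adMatrix n x).det = 1 := by
  have hpos := pos_of_mem_spinPlus n (fun x => (adMatrix n x).det)
    (continuous_adMatrix n).matrix_det
    (fun y hy => by simpa [hy] using det_adMatrix_sq n y)
    (by simp [adMatrix_one]) x hx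
  have := det_adMatrix_sq n x
  nlinarith

theorem adMatrix_mem_hyperboloid (n : ℕ) (x : SpinGroup n) (hx : x ∈ SpinPlus n)
    (w : Fin (n + 1) → ℝ) (hw : w ∈ hyperboloid n) :
    (adMatrix n x).mulVec w ∈ hyperboloid n := by
  refine ⟨by rw [lorentz_adMatrix]; exact hw.1, ?_⟩
  refine pos_of_mem_spinPlus n (fun x => (adMatrix n x).mulVec w (Fin.last n)) ?_ ?_ ?_ x hx
  · exact (continuous_apply (Fin.last n)).comp
      ((continuous_adMatrix n).matrix_mulVec (continuous_const (y := w)))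
  · intro y hy
    have h := lorentz_adMatrix n y w
    rw [hw.1, lorentz_apply, hy] at h
    have : 0 ≤ ∑ i : Fin n, (adMatrix n y).mulVec w i.castSucc ^ 2 :=
      Finset.sum_nonneg fun i _ => sq_nonneg _
    linarith
  · simpa [adMatrix_one] using hw.2

/-- `Ad` as a homomorphism from `Spin(n,1)` to `GL(n+1, ℝ)`. -/
def Ad (n : ℕ) : SpinGroup n →* GL (Fin (n + 1)) ℝ :=
  MonoidHom.toHomUnits
    { toFun := adMatrix n
      map_one' := adMatrix_one n
      map_mul' := adMatrix_mul n }

theorem Ad_mem_SOPlus (n : ℕ) (x : SpinPlus n) : Ad n x.1 ∈ SOPlus n := by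
  refine ⟨⟨lorentz_adMatrix n x.1, ?_⟩, det_adMatrix n x.1 x.2⟩
  refine Set.Subset.antisymm ?_ ?_
  · rintro _ ⟨w, hw, rfl⟩
    exact adMatrix_mem_hyperboloid n x.1 x.2 w hw
  · intro w hw
    refine ⟨_, adMatrix_mem_hyperboloid n x.1⁻¹ (inv_mem x.2) w hw, ?_⟩
    change (adMatrix n x.1).mulVec _ = w
    rw [Matrix.mulVec_mulVec, ← adMatrix_mul, mul_inv_cancel, adMatrix_one, Matrix.one_mulVec]

/-- The double covering `η : Spin⁺(n,1) → SO⁺(n,1)`, `η(x)w = x w x⁻¹`. -/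
def eta (n : ℕ) : SpinPlus n →* SOPlus n :=
  ((Ad n).comp (SpinPlus n).subtype).codRestrict (SOPlus n) (Ad_mem_SOPlus n)

/-- The defining property of `η`. -/
theorem vec_eta (n : ℕ) (x : SpinPlus n) (w : Fin (n + 1) → ℝ) :
    vec n ((eta n x).1.1.mulVec w) =
      toCl x * vec n w * toCl x⁻¹ :=
  vec_adMatrix n x.1 w

/-! ### Spin structures on `Γ\Hⁿ` and lifting of isometries -/

/-- The map `ρ : Γ'\Spin⁺(n,1) → Γ\SO⁺(n,1)`, `ρ(Γ'g) = Γη(g)`, induced by `η` when `η(Γ') = Γ`. -/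
def spinStructure {n : ℕ} (Γ : Subgroup (SOPlus n)) (Γ' : Subgroup (SpinPlus n))
    (h : Γ'.map (eta n) = Γ) : OrbitSpace Γ' (SpinPlus n) → OrbitSpace Γ (SOPlus n) :=
  Quotient.lift (fun g => orbitMk Γ (eta n g)) (by
    rintro _ y ⟨γ, rfl⟩
    refine Quotient.sound ⟨⟨eta n γ.1, ?_⟩, ?_⟩
    · rw [← h]
      exact ⟨γ.1, γ.2, rfl⟩
    · change eta n γ.1 * eta n y = eta n (γ.1 * y)
      rw [map_mul])

/-- Smoothness of a map `F : Γ'\Spin⁺(n,1) → Γ'\Spin⁺(n,1)`, for `Γ'` discrete. Here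
`Spin⁺(n,1)` is an embedded submanifold of the vector space `Cℓ(n,1)` and
`Spin⁺(n,1) → Γ'\Spin⁺(n,1)` is a smooth covering, so `F` is smooth when near each `g` it lifts to a
map `Spin⁺(n,1) → Spin⁺(n,1)` that is the restriction of a smooth map on a neighbourhood
of `g` in `Cℓ(n,1)`. -/
def IsSmooth {n : ℕ} (Γ' : Subgroup (SpinPlus n))
    (F : OrbitSpace Γ' (SpinPlus n) → OrbitSpace Γ' (SpinPlus n)) : Prop :=
  ∀ g : SpinPlus n, ∃ U ∈ 𝓝 (toCl g), ∃ s : Cl n → Cl n, ContDiffOn ℝ ∞ s U ∧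
    ∀ x : SpinPlus n, toCl x ∈ U →
      ∃ y : SpinPlus n, toCl y = s (toCl x) ∧ F (orbitMk Γ' x) = orbitMk Γ' y

/-- Self-diffeomorphisms of `Γ'\Spin⁺(n,1)`. -/
def IsDiffeo {n : ℕ} (Γ' : Subgroup (SpinPlus n))
    (F : OrbitSpace Γ' (SpinPlus n) → OrbitSpace Γ' (SpinPlus n)) : Prop :=
  IsSmooth Γ' F ∧ ∃ G, Function.LeftInverse G F ∧ Function.RightInverse G F ∧ IsSmooth Γ' G

/-- `Ψ` is the self-map `φ_⋆` of the frame bundle `Γ\SO⁺(n,1)` induced by `φ : Γ\Hⁿ → Γ\Hⁿ`: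
`φ(Γx) = Γfx` and `Ψ(Γg) = Γfg` for some `f` in `SO⁺(n,1)` with `f Γ f⁻¹ = Γ`. (Such an `f` exists
if `φ` is an orientation preserving isometry, and is unique up to left multiplication by `Γ`.) -/
def IsInducedFrameMap {n : ℕ} (Γ : Subgroup (SOPlus n))
    (φ : OrbitSpace Γ (HSpace n) → OrbitSpace Γ (HSpace n))
    (Ψ : OrbitSpace Γ (SOPlus n) → OrbitSpace Γ (SOPlus n)) : Prop :=
  ∃ (f : SOPlus n) (hf : conjSubgroup f Γ = Γ),
    φ = inducedMap Γ (HSpace n) f hf ∧ Ψ = inducedMap Γ (SOPlus n) f hf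

/-- `φ : Γ\Hⁿ → Γ\Hⁿ` lifts to the spin structure `ρ : Γ'\Spin⁺(n,1) → Γ\SO⁺(n,1)`: there is a
self-diffeomorphism `Φ` of `Γ'\Spin⁺(n,1)` with `ρ Φ = φ_⋆ ρ`. -/
def LiftsToSpinStructure {n : ℕ} (Γ : Subgroup (SOPlus n)) (Γ' : Subgroup (SpinPlus n))
    (h : Γ'.map (eta n) = Γ) (φ : OrbitSpace Γ (HSpace n) → OrbitSpace Γ (HSpace n)) : Prop :=
  ∃ Ψ, IsInducedFrameMap Γ φ Ψ ∧ ∃ Φ, IsDiffeo Γ' Φ ∧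
    spinStructure Γ Γ' h ∘ Φ = Ψ ∘ spinStructure Γ Γ' h

end HypSpin

end

/-! ### Even central elements of a Clifford algebra -/

namespace CliffordAlgebra

variable {R M : Type*} [CommRing R] [AddCommGroup M] [Module R M] {Q : QuadraticForm R M}

/-! If `f'` normalizes `Γ'`, left multiplication by `f'` descends to `Γ'\Spin⁺(n,1)`, with inverse
induced by `f'⁻¹`, and covers the frame map of `η(f') = f`.

Conversely, let `Φ` be a lift. The isometry determines `f` up to left multiplication by `Γ`
(`exists_mul_eq_of_inducedMap_eq`), so `Φ` covers left multiplication by `f`. Near each point `Φ`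
has a continuous lift `y`, and `y x * (f' * x)⁻¹` lies in `η⁻¹(Γ)`. That set is discrete, because
`Γ` and the kernel of `η` are; hence the quotient is locally constant, and up to an element of `Γ'`
it is some `k` in the kernel (`IsSmooth.eventually_eq`). Since `η` is injective on `Γ'`, this `k` is
unique, so it is locally constant and, `Spin⁺(n,1)` being connected, global
(`IsSmooth.exists_forall_eq`). Now `Γ'x ↦ Γ'kf'x` is well defined and `k` is central, which forces
`f' Γ' f'⁻¹ ⊆ Γ'`; equality follows by pushing to `Γ`.

The algebraic input is that the kernel of `η` lies in `{1, -1}`. A kernel element is even and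
commutes with all vectors. By the identity below all its contractions vanish, so it is a scalar, and
its reversion norm shows that this scalar squares to 1. -/

theorem ι_mul_sub_involute_mul_ι (v : M) (x : CliffordAlgebra Q) :
    ι Q v * x - involute x * ι Q v = contractLeft (QuadraticMap.polarBilin Q v) x := by
  induction x using left_induction with
  | algebraMap r =>
    rw [AlgHom.commutes, contractLeft_algebraMap, Algebra.commutes, sub_self]
  | add x y hx hy => rw [map_add, map_add, ← hx, ← hy]; noncomm_ring
  -- Moving `v` past `w` costs the polar form, and `involute` changes the sign of `w`; the twisted
  -- commutator thus obeys the antiderivation rule of contraction.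
  | ι_mul x w hx =>
    rw [contractLeft_ι_mul, ← hx, map_mul, involute_ι, QuadraticMap.polarBilin_apply_apply,
      Algebra.smul_def, ← ι_mul_ι_add_swap]
    noncomm_ring

end CliffordAlgebra

/-! ### The degree operator on the exterior algebra. -/

namespace ExteriorAlgebra

variable {K ι : Type*} [Field K] [Fintype ι] [DecidableEq ι]

-- The sum over `i` of "contract with the `i`-th coordinate, then wedge with the `i`-th basis
-- vector" is a derivation that fixes vectors, so it counts degree.
open CliffordAlgebra in
theorem sum_ι_mul_contractLeft {k : ℕ} {x : ExteriorAlgebra K (ι → K)} (hx : x ∈ ⋀[K]^k (ι → K)) :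
    ∑ i, ExteriorAlgebra.ι K (Pi.single i 1) * contractLeft (LinearMap.proj i) x = k • x := by
  induction hx using Submodule.pow_induction_on_left' with
  | algebraMap r =>
    exact (Finset.sum_eq_zero fun i _ => by
      rw [show algebraMap K (ExteriorAlgebra K (ι → K)) r = algebraMap K (CliffordAlgebra 0) r
        from rfl, contractLeft_algebraMap]; exact mul_zero _).trans (by simp)
  | add x y i hx hy ihx ihy =>
    simp only [map_add, mul_add, Finset.sum_add_distrib, ihx, ihy, smul_add]
  | mem_mul m hm i x hx ih =>
    obtain ⟨v, rfl⟩ := hm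
    have hv : ∑ j, v j • ExteriorAlgebra.ι K (Pi.single j (1 : K)) = ExteriorAlgebra.ι K v := by
      simp only [← map_smul, ← map_sum]
      congr 1
      ext j
      simp [Finset.sum_apply, Pi.single_apply]
    have hterm : ∀ j, ExteriorAlgebra.ι K (Pi.single j 1) *
        contractLeft (LinearMap.proj j) (ExteriorAlgebra.ι K v * x) =
        v j • ExteriorAlgebra.ι K (Pi.single j (1 : K)) * x + ExteriorAlgebra.ι K v *
          (ExteriorAlgebra.ι K (Pi.single j 1) * contractLeft (LinearMap.proj j) x) := by
      intro j
      have h1 : contractLeft (LinearMap.proj j) (ExteriorAlgebra.ι K v * x) =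
          v j • x - ExteriorAlgebra.ι K v * contractLeft (LinearMap.proj j) x :=
        contractLeft_ι_mul _ _ _
      -- This sign cancels the one from the antiderivation rule, leaving a derivation.
      have h2 : ExteriorAlgebra.ι K (Pi.single j (1 : K)) * ExteriorAlgebra.ι K v =
          -(ExteriorAlgebra.ι K v * ExteriorAlgebra.ι K (Pi.single j (1 : K))) :=
        eq_neg_of_add_eq_zero_left (ExteriorAlgebra.ι_add_mul_swap _ _)
      rw [h1, mul_sub, ← mul_assoc, h2, neg_mul, sub_neg_eq_add, mul_assoc, mul_smul_comm,
        smul_mul_assoc]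
    simp only [hterm]
    rw [Finset.sum_add_distrib, ← Finset.sum_mul, hv, ← Finset.mul_sum, ih, mul_smul_comm,
      Nat.succ_eq_add_one, add_smul, one_smul, add_comm]

theorem decompose_sum_ι_mul_contractLeft (x : ExteriorAlgebra K (ι → K)) (k : ℕ) :
    (DirectSum.decompose (fun k => ⋀[K]^k (ι → K))
      (∑ i, ExteriorAlgebra.ι K (Pi.single i 1) *
        CliffordAlgebra.contractLeft (LinearMap.proj i) x) k : ExteriorAlgebra K (ι → K)) =
      k • (DirectSum.decompose (fun k => ⋀[K]^k (ι → K)) x k : ExteriorAlgebra K (ι → K)) := by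
  induction x using DirectSum.Decomposition.inductionOn (fun k => ⋀[K]^k (ι → K)) with
  | zero => simp
  | homogeneous m =>
    rename_i j
    have hj : DirectSum.decompose (fun k => ⋀[K]^k (ι → K)) (j • (m : ExteriorAlgebra K (ι → K))) =
        j • DirectSum.decompose (fun k => ⋀[K]^k (ι → K)) (m : ExteriorAlgebra K (ι → K)) :=
      map_nsmul (DirectSum.decomposeAddEquiv _) j _
    have hjk : (DirectSum.decompose (fun k => ⋀[K]^k (ι → K))
        (j • (m : ExteriorAlgebra K (ι → K))) k : ExteriorAlgebra K (ι → K)) =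
        j • (DirectSum.decompose (fun k => ⋀[K]^k (ι → K)) (m : ExteriorAlgebra K (ι → K)) k :
          ExteriorAlgebra K (ι → K)) := by
      rw [hj]
      rfl
    rw [sum_ι_mul_contractLeft m.2, hjk]
    by_cases h : j = k
    · subst h
      rfl
    · rw [DirectSum.decompose_of_mem_ne (fun k => ⋀[K]^k (ι → K)) m.2 h, smul_zero, smul_zero]
  | add x y hx hy =>
    simp only [map_add, mul_add, Finset.sum_add_distrib, DirectSum.decompose_add,
      DirectSum.add_apply, Submodule.coe_add, hx, hy, smul_add]

/-- The degree operator kills `x` and acts on its degree `k` component as multiplication by `k`; in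
characteristic zero only degree 0 survives. -/
theorem mem_range_algebraMap_of_contractLeft_eq_zero [CharZero K]
    {x : ExteriorAlgebra K (ι → K)}
    (hx : ∀ i : ι, CliffordAlgebra.contractLeft (LinearMap.proj i) x = 0) :
    ∃ r : K, x = algebraMap K _ r := by
  have hk : ∀ k ≠ 0, (DirectSum.decompose (fun k => ⋀[K]^k (ι → K)) x k :
      ExteriorAlgebra K (ι → K)) = 0 := by
    intro k hk
    have h := decompose_sum_ι_mul_contractLeft x k
    rw [Finset.sum_eq_zero fun i _ => by rw [hx i]; exact mul_zero _, DirectSum.decompose_zero,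
      DirectSum.zero_apply, ZeroMemClass.coe_zero, ← Nat.cast_smul_eq_nsmul K] at h
    exact (smul_eq_zero.1 h.symm).resolve_left (Nat.cast_ne_zero.2 hk)
  classical
  have h0 : x = (DirectSum.decompose (fun k => ⋀[K]^k (ι → K)) x 0 :
      ExteriorAlgebra K (ι → K)) := by
    conv_lhs => rw [← DirectSum.sum_support_decompose (fun k => ⋀[K]^k (ι → K)) x]
    refine Finset.sum_eq_single 0 (fun k _ h => hk k h) fun h => ?_
    simpa using h
  have hmem := (DirectSum.decompose (fun k => ⋀[K]^k (ι → K)) x 0).2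
  rw [← h0, ExteriorAlgebra.exteriorPower, pow_zero, Submodule.mem_one] at hmem
  obtain ⟨r, hr⟩ := hmem
  exact ⟨r, hr.symm⟩

end ExteriorAlgebra

/-! ### Even elements of `Cℓ(n,1)` that commute with all vectors. -/

namespace HypSpin

/-- Nondegeneracy of the Lorentzian form, in the shape needed to turn contraction by a polar form
into contraction by a coordinate. -/
theorem polarBilin_neg_lorentz_single (n : ℕ) (i : Fin (n + 1)) :
    ∃ c : ℝ, c ≠ 0 ∧ QuadraticMap.polarBilin (-lorentz n) (Pi.single i 1) =
      c • (LinearMap.proj i : (Fin (n + 1) → ℝ) →ₗ[ℝ] ℝ) := by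
  refine ⟨-2 * (if i = Fin.last n then -1 else 1), by split_ifs <;> norm_num, ?_⟩
  refine LinearMap.ext fun w => ?_
  simp only [QuadraticMap.polarBilin_apply_apply, QuadraticMap.polar, neg_apply,
    lorentz, QuadraticMap.weightedSumSquares_apply, LinearMap.smul_apply, LinearMap.proj_apply,
    Pi.add_apply, smul_eq_mul]
  rw [← Finset.sum_neg_distrib, ← Finset.sum_neg_distrib, ← Finset.sum_neg_distrib,
    ← Finset.sum_sub_distrib, ← Finset.sum_sub_distrib, Finset.sum_eq_single i]
  · simp only [Pi.single_eq_same]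
    ring
  · intro j _ hj
    simp only [Pi.single_eq_of_ne hj]
    ring
  · simp

/-- For even `x` the twisted commutator is the ordinary one, so all coordinate contractions of `x`
vanish. Evenness matters: when `n + 1` is odd, the volume element is central but not scalar. -/
theorem exists_eq_algebraMap_of_commute {n : ℕ} {x : Cl n}
    (hx : CliffordAlgebra.involute x = x) (hc : ∀ v, vec n v * x = x * vec n v) :
    ∃ r : ℝ, x = algebraMap ℝ (Cl n) r := by
  have h0 : ∀ i : Fin (n + 1), CliffordAlgebra.contractLeft (LinearMap.proj i) x = 0 := by
    intro i
    obtain ⟨c, hc0, hci⟩ := polarBilin_neg_lorentz_single n i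
    have h := CliffordAlgebra.ι_mul_sub_involute_mul_ι (Pi.single i 1) x
    rw [hx, hc, sub_self, hci, map_smul, LinearMap.smul_apply] at h
    exact (smul_eq_zero.1 h.symm).resolve_left hc0
  obtain ⟨r, hr⟩ := ExteriorAlgebra.mem_range_algebraMap_of_contractLeft_eq_zero
    (x := CliffordAlgebra.equivExterior (-lorentz n) x) fun i => by
      -- The linear identification with the exterior algebra commutes with contraction.
      have h := CliffordAlgebra.changeForm_contractLeft
        (CliffordAlgebra.changeForm.associated_neg_proof (Q := -lorentz n)) (LinearMap.proj i) x
      rw [h0 i, map_zero] at h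
      exact h.symm
  refine ⟨r, (CliffordAlgebra.equivExterior (-lorentz n)).injective (hr.trans ?_)⟩
  exact (CliffordAlgebra.changeForm_algebraMap
    CliffordAlgebra.changeForm.associated_neg_proof r).symm

/-! ### Units, reversion and the topology of the spin group -/

/-- The product telescopes from the inside, each factor contributing the scalar `v² = -f_n(v) = ±1`.
-/
theorem reverse_mul_self {n : ℕ} (x : SpinGroup n) :
    ∃ ε : ℝ, ε * ε = 1 ∧
      CliffordAlgebra.reverse (x.1 : Cl n) * (x.1 : Cl n) = algebraMap ℝ (Cl n) ε := by
  obtain ⟨l, hl, -, hx⟩ := x.2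
  rw [hx]
  clear hx
  induction l with
  | nil => exact ⟨1, by simp, by simp⟩
  | cons v l ih =>
    obtain ⟨ε, hε, h⟩ := ih fun w hw => hl w (List.mem_cons_of_mem _ hw)
    refine ⟨-lorentz n v * ε, ?_, ?_⟩
    · rcases hl v List.mem_cons_self with h | h <;> simp [h, hε]
    · rw [List.map_cons, List.prod_cons, CliffordAlgebra.reverse.map_mul,
        CliffordAlgebra.reverse_ι, mul_assoc, ← mul_assoc (vec n v), vec_mul_vec,
        ← mul_assoc, ← Algebra.commutes, mul_assoc, h, map_mul]

/-- The inverse is `ε` times the reversion. Writing `ε` as `reverse x * x` gives an expression that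
is continuous on all of `Cℓ(n,1)`. -/
theorem coe_inv_eq {n : ℕ} (x : SpinGroup n) :
    ((x.1⁻¹ : (Cl n)ˣ) : Cl n) = CliffordAlgebra.reverse (x.1 : Cl n) * (x.1 : Cl n) *
      CliffordAlgebra.reverse (x.1 : Cl n) := by
  obtain ⟨ε, hε, h⟩ := reverse_mul_self x
  rw [h]
  refine Units.inv_eq_of_mul_eq_one_left ?_
  rw [mul_assoc, h, ← map_mul, hε, map_one]

theorem involute_coe {n : ℕ} (x : SpinGroup n) :
    CliffordAlgebra.involute (x.1 : Cl n) = (x.1 : Cl n) := by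
  obtain ⟨l, -, hle, hx⟩ := x.2
  rw [hx, CliffordAlgebra.involute_prod_map_ι, hle.neg_one_pow, one_smul]

theorem toCl_one {n : ℕ} : toCl (1 : SpinPlus n) = 1 := rfl

theorem toCl_mul {n : ℕ} (x y : SpinPlus n) : toCl (x * y) = toCl x * toCl y := rfl

theorem toCl_injective {n : ℕ} : Function.Injective (toCl (n := n)) :=
  Units.val_injective.comp (Subtype.val_injective.comp Subtype.val_injective)

theorem continuous_toCl {n : ℕ} : Continuous (toCl (n := n)) :=
  Units.continuous_val.comp (continuous_subtype_val.comp continuous_subtype_val)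

/-- The topology of units records the pair `(x, x⁻¹)`; on the spin group the second entry is a
continuous function of the first, so the first suffices. -/
theorem isInducing_toCl {n : ℕ} : Topology.IsInducing (toCl (n := n)) := by
  have hemb : Topology.IsInducing fun x : SpinPlus n => Units.embedProduct (Cl n) x.1.1 :=
    Units.isEmbedding_embedProduct.isInducing.comp
      (Topology.IsInducing.subtypeVal.comp Topology.IsInducing.subtypeVal)
  have hrev : Continuous (CliffordAlgebra.reverse : Cl n →ₗ[ℝ] Cl n) :=
    LinearMap.continuous_of_finiteDimensional _
  have hF : Continuous fun a : Cl n => (a, MulOpposite.op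
      (CliffordAlgebra.reverse a * a * CliffordAlgebra.reverse a)) :=
    continuous_id.prodMk (MulOpposite.continuous_op.comp ((hrev.mul continuous_id).mul hrev))
  refine Topology.IsInducing.of_comp continuous_toCl hF ?_
  convert hemb using 1
  funext x
  exact Prod.ext rfl (congrArg MulOpposite.op (coe_inv_eq x.1).symm)

instance (n : ℕ) : PreconnectedSpace (SpinPlus n) :=
  isPreconnected_iff_preconnectedSpace.1
    (isPreconnected_connectedComponent : IsPreconnected (connectedComponent (1 : SpinGroup n)))

/-! ### The covering `η` -/

theorem continuous_eta (n : ℕ) : Continuous (eta n) := by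
  refine Continuous.subtype_mk (Units.continuous_iff.2 ⟨?_, ?_⟩) _
  · exact (continuous_adMatrix n).comp continuous_subtype_val
  · exact ((continuous_adMatrix n).comp continuous_inv).comp continuous_subtype_val

theorem toCl_eq_of_eta_eq_one {n : ℕ} {x : SpinPlus n} (hx : eta n x = 1) :
    ∃ r : ℝ, r * r = 1 ∧ toCl x = algebraMap ℝ (Cl n) r := by
  have hc : ∀ v, vec n v * toCl x = toCl x * vec n v := by
    intro v
    have h := vec_eta n x v
    rw [hx] at h
    have hv : ((1 : SOPlus n).1.1).mulVec v = v := Matrix.one_mulVec v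
    rw [hv] at h
    rw [h, mul_assoc, ← toCl_mul, inv_mul_cancel, toCl_one, mul_one, ← h]
  obtain ⟨r, hr⟩ := exists_eq_algebraMap_of_commute (involute_coe x.1) hc
  obtain ⟨ε, hε, h⟩ := reverse_mul_self x.1
  refine ⟨r, ?_, hr⟩
  have hinj : Function.Injective (algebraMap ℝ (Cl n)) := by
    have : Nontrivial (Cl n) := inferInstance
    exact (algebraMap ℝ (Cl n)).injective
  rw [hr, CliffordAlgebra.reverse.commutes, ← map_mul] at h
  have h' : r * r = ε := hinj h
  -- The reversion norm `ε` is 1 or -1, and being the square of a real it must be 1.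
  have hpos : 0 ≤ ε := h' ▸ mul_self_nonneg r
  rw [h']
  nlinarith

theorem commute_of_eta_eq_one {n : ℕ} {k : SpinPlus n} (hk : eta n k = 1) (x : SpinPlus n) :
    k * x = x * k := by
  obtain ⟨r, -, hr⟩ := toCl_eq_of_eta_eq_one hk
  refine toCl_injective ?_
  rw [toCl_mul, toCl_mul, hr, Algebra.commutes]

/-- Discreteness of the kernel: its only possible element other than 1 is -1, which a neighbourhood
of 1 avoids. -/
theorem eventually_eq_one_of_eta_eq_one (n : ℕ) :
    ∀ᶠ k in 𝓝 (1 : SpinPlus n), eta n k = 1 → k = 1 := by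
  have hne : (-1 : Cl n) ≠ 1 := by
    have : CharZero (Cl n) := algebraRat.charZero _
    norm_num
  have h : ∀ᶠ k in 𝓝 (1 : SpinPlus n), toCl k ≠ -1 :=
    continuous_toCl.continuousAt.eventually_ne hne.symm
  filter_upwards [h] with k hk hk1
  obtain ⟨r, hr, hkr⟩ := toCl_eq_of_eta_eq_one hk1
  rcases mul_self_eq_one_iff.1 hr with rfl | rfl
  · exact toCl_injective (by rw [hkr, map_one, toCl_one])
  · exact absurd (by rw [hkr, map_neg, map_one]) hk

/-- Points whose images under `η` lie in a discrete subgroup are isolated from each other. -/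
theorem eventually_eq_of_eta_mem {n : ℕ} (Γ : Subgroup (SOPlus n)) [DiscreteTopology Γ]
    {c : SpinPlus n} (hc : eta n c ∈ Γ) :
    ∀ᶠ x in 𝓝 c, eta n x ∈ Γ → x = c := by
  obtain ⟨V, hV, hVΓ⟩ : ∃ V ∈ 𝓝 (eta n c), ∀ y ∈ V, y ∈ Γ → y = eta n c := by
    have h : {(⟨eta n c, hc⟩ : Γ)} ∈ 𝓝 (⟨eta n c, hc⟩ : Γ) := by simp
    rw [nhds_subtype_eq_comap] at h
    obtain ⟨V, hV, h⟩ := h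
    exact ⟨V, hV, fun y hy hyΓ => congrArg Subtype.val (@h ⟨y, hyΓ⟩ hy)⟩
  have h1 : ∀ᶠ x in 𝓝 c, eta n x ∈ V := (continuous_eta n).continuousAt hV
  have hcont : Filter.Tendsto (fun x : SpinPlus n => c⁻¹ * x) (𝓝 c) (𝓝 1) := by
    have h := (continuous_const_mul c⁻¹).tendsto c
    rwa [inv_mul_cancel] at h
  -- Discreteness of `Γ` gives `η(x) = η(c)` near `c`; then `c⁻¹ * x` is a kernel element near 1.
  filter_upwards [h1, hcont.eventually (eventually_eq_one_of_eta_eq_one n)] with x hx hx1 hxΓ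
  have : eta n (c⁻¹ * x) = 1 := by
    rw [map_mul, map_inv, hVΓ _ hx hxΓ, inv_mul_cancel]
  exact (inv_mul_eq_one.1 (hx1 this)).symm

/-! ### Orbit spaces and isometries -/

theorem orbitMk_eq_iff {G X : Type*} [Group G] [MulAction G X] {Γ : Subgroup G} {x y : X} :
    orbitMk Γ x = orbitMk Γ y ↔ ∃ γ ∈ Γ, x = γ • y := by
  refine Quotient.eq.trans ?_
  constructor
  · rintro ⟨γ, h⟩
    exact ⟨γ.1, γ.2, h.symm⟩
  · rintro ⟨γ, hγ, h⟩
    exact ⟨⟨γ, hγ⟩, h.symm⟩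

theorem conj_mem_of_conjSubgroup_eq {G : Type*} [Group G] {Γ : Subgroup G} {f γ : G}
    (hf : conjSubgroup f Γ = Γ) (hγ : γ ∈ Γ) : f * γ * f⁻¹ ∈ Γ :=
  hf.le ⟨γ, hγ, rfl⟩

theorem conjSubgroup_inv_eq {G : Type*} [Group G] {Γ : Subgroup G} {f : G}
    (hf : conjSubgroup f Γ = Γ) : conjSubgroup f⁻¹ Γ = Γ := by
  ext γ
  constructor
  · rintro ⟨δ, hδ, rfl⟩
    obtain ⟨β, hβ, h⟩ := hf.ge hδ
    change f * β * f⁻¹ = δ at h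
    change f⁻¹ * δ * f⁻¹⁻¹ ∈ Γ
    rw [← h]
    simpa [mul_assoc] using hβ
  · intro h
    exact ⟨f * γ * f⁻¹, conj_mem_of_conjSubgroup_eq hf h, by
      change f⁻¹ * (f * γ * f⁻¹) * f⁻¹⁻¹ = γ
      group⟩

/-- This makes a discrete `Γ` countable. -/
instance (n : ℕ) : SecondCountableTopology (GL (Fin (n + 1)) ℝ) :=
  have : SecondCountableTopology (Matrix (Fin (n + 1)) (Fin (n + 1)) ℝ) :=
    inferInstanceAs (SecondCountableTopology (Fin (n + 1) → Fin (n + 1) → ℝ))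
  have : SecondCountableTopology (Matrix (Fin (n + 1)) (Fin (n + 1)) ℝ)ᵐᵒᵖ :=
    MulOpposite.opHomeomorph.symm.isInducing.secondCountableTopology
  Units.isEmbedding_embedProduct.isInducing.secondCountableTopology

theorem continuous_lorentz (n : ℕ) : Continuous (lorentz n) := by
  simp only [funext (lorentz_apply n)]
  fun_prop

/-- A linear map that agrees at each point of `Hⁿ` with one of countably many linear maps is one of
them. -/
theorem exists_eq_of_forall_hyperboloid {n : ℕ} {ι : Type*} [Countable ι]
    (A : Matrix (Fin (n + 1)) (Fin (n + 1)) ℝ) (B : ι → Matrix (Fin (n + 1)) (Fin (n + 1)) ℝ)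
    (h : ∀ x ∈ hyperboloid n, ∃ i, A.mulVec x = (B i).mulVec x) : ∃ i, A = B i := by
  by_contra! hne
  -- `C` is the open cone over `Hⁿ`. It has positive measure, so countably many proper subspaces
  -- cannot cover it.
  let C : Set (Fin (n + 1) → ℝ) := {x | lorentz n x < 0 ∧ 0 < x (Fin.last n)}
  have hC : IsOpen C := (isOpen_lt (continuous_lorentz n) continuous_const).inter
    (isOpen_lt continuous_const (continuous_apply _))
  have hCne : C.Nonempty := by
    refine ⟨Pi.single (Fin.last n) 1, ?_, by simp⟩
    rw [lorentz_apply, Finset.sum_eq_zero fun i _ => by simp [(Fin.castSucc_lt_last i).ne]]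
    simp
  let K : ι → Submodule ℝ (Fin (n + 1) → ℝ) := fun i => LinearMap.ker (Matrix.toLin' (A - B i))
  have hK : ∀ i, MeasureTheory.volume (K i : Set (Fin (n + 1) → ℝ)) = 0 := by
    intro i
    refine MeasureTheory.Measure.addHaar_submodule _ _ fun htop => hne i ?_
    exact sub_eq_zero.1 (Matrix.toLin'.map_eq_zero_iff.1 (LinearMap.ker_eq_top.1 htop))
  have hcover : C ⊆ ⋃ i, (K i : Set (Fin (n + 1) → ℝ)) := by
    rintro x ⟨hx, hx0⟩
    have hs : 0 < Real.sqrt (-lorentz n x) := Real.sqrt_pos.2 (neg_pos.2 hx)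
    -- Rescaling moves `x` onto `Hⁿ`; the resulting linear equation is homogeneous, so it scales
    -- back.
    obtain ⟨i, hi⟩ := h ((Real.sqrt (-lorentz n x))⁻¹ • x) ⟨by
      rw [QuadraticMap.map_smul, smul_eq_mul, ← mul_inv, Real.mul_self_sqrt (neg_pos.2 hx).le]
      field_simp
      rw [div_self hx.ne], mul_pos (inv_pos.2 hs) hx0⟩
    rw [Matrix.mulVec_smul, Matrix.mulVec_smul] at hi
    refine Set.mem_iUnion.2 ⟨i, ?_⟩
    change Matrix.toLin' (A - B i) x = 0
    rw [Matrix.toLin'_apply, Matrix.sub_mulVec, sub_eq_zero]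
    exact smul_right_injective _ (inv_pos.2 hs).ne' hi
  exact (hC.measure_pos MeasureTheory.volume hCne).ne'
    (MeasureTheory.measure_mono_null hcover (MeasureTheory.measure_iUnion_null hK))

/-- An isometry of `Γ\Hⁿ` determines its lift to `SO⁺(n,1)` up to left multiplication by `Γ`. -/
theorem exists_mul_eq_of_inducedMap_eq {n : ℕ} {Γ : Subgroup (SOPlus n)} [DiscreteTopology Γ]
    {f g : SOPlus n} {hf : conjSubgroup f Γ = Γ} {hg : conjSubgroup g Γ = Γ}
    (h : inducedMap Γ (HSpace n) f hf = inducedMap Γ (HSpace n) g hg) :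
    ∃ γ ∈ Γ, f = γ * g := by
  have : Countable Γ := countable_of_Lindelof_of_discrete
  -- Pointwise `fx = γgx` with `γ` depending on `x`; countability of `Γ` yields a single `γ`.
  obtain ⟨γ, hγ⟩ := exists_eq_of_forall_hyperboloid f.1.1
    (fun γ : Γ => ((γ : SOPlus n) * g).1.1) fun x hx => by
      obtain ⟨γ, hγ, hx'⟩ := orbitMk_eq_iff.1 (congrFun h (orbitMk Γ ⟨x, hx⟩))
      rw [smul_smul] at hx'
      exact ⟨⟨γ, hγ⟩, congrArg Subtype.val hx'⟩
  exact ⟨γ, γ.2, Subtype.ext (Units.ext hγ)⟩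

/-! ### Lifting isometries to the spin structure -/

theorem isSmooth_inducedMap {n : ℕ} (Γ' : Subgroup (SpinPlus n)) (g : SpinPlus n)
    (hg : conjSubgroup g Γ' = Γ') : IsSmooth Γ' (inducedMap Γ' (SpinPlus n) g hg) := by
  intro x
  refine ⟨Set.univ, Filter.univ_mem, fun a => toCl g * a, ?_, fun y _ => ⟨g * y, rfl, rfl⟩⟩
  exact (LinearMap.toContinuousLinearMap (LinearMap.mulLeft ℝ (toCl g))).contDiff.contDiffOn

theorem inducedMap_inv_leftInverse {G : Type*} [Group G] {Γ : Subgroup G} {X : Type*}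
    [MulAction G X] {f g : G} (hf : conjSubgroup f Γ = Γ) (hg : conjSubgroup g Γ = Γ)
    (h : g * f = 1) : Function.LeftInverse (inducedMap Γ X g hg) (inducedMap Γ X f hf) := by
  intro x
  induction x using Quotient.inductionOn with
  | h x =>
    change orbitMk Γ (g • f • x) = orbitMk Γ x
    rw [smul_smul, h, one_smul]

theorem isDiffeo_inducedMap {n : ℕ} (Γ' : Subgroup (SpinPlus n)) (g : SpinPlus n)
    (hg : conjSubgroup g Γ' = Γ') : IsDiffeo Γ' (inducedMap Γ' (SpinPlus n) g hg) :=
  ⟨isSmooth_inducedMap Γ' g hg, inducedMap Γ' (SpinPlus n) g⁻¹ (conjSubgroup_inv_eq hg),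
    inducedMap_inv_leftInverse _ _ (inv_mul_cancel g),
    inducedMap_inv_leftInverse _ _ (mul_inv_cancel g), isSmooth_inducedMap Γ' _ _⟩

/-- A smooth map covering left multiplication by `f = η(f')` is locally left multiplication by
`k f'` for some `k` in the kernel of `η`. -/
theorem IsSmooth.eventually_eq {n : ℕ} {Γ : Subgroup (SOPlus n)} [DiscreteTopology Γ]
    {Γ' : Subgroup (SpinPlus n)} (hmap : Γ'.map (eta n) = Γ) {f' : SpinPlus n}
    {Φ : OrbitSpace Γ' (SpinPlus n) → OrbitSpace Γ' (SpinPlus n)} (hΦ : IsSmooth Γ' Φ)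
    (hcov : ∀ x, spinStructure Γ Γ' hmap (Φ (orbitMk Γ' x)) = orbitMk Γ (eta n (f' * x)))
    (g : SpinPlus n) :
    ∃ k, eta n k = 1 ∧ ∀ᶠ x in 𝓝 g, Φ (orbitMk Γ' x) = orbitMk Γ' (k * f' * x) := by
  obtain ⟨U, hU, s, hs, hlift⟩ := hΦ g
  choose! y hy hΦy using hlift
  have hUg : ∀ᶠ x in 𝓝 g, toCl x ∈ U := continuous_toCl.continuousAt hU
  -- The chosen `y` is continuous at `g` because its image in `Cℓ(n,1)` agrees near `g` with the
  -- continuous map `s`.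
  have hyg : Filter.Tendsto y (𝓝 g) (𝓝 (y g)) := by
    rw [isInducing_toCl.tendsto_nhds_iff, hy g (mem_of_mem_nhds hU)]
    have hsg : Filter.Tendsto (fun x : SpinPlus n => s (toCl x)) (𝓝 g) (𝓝 (s (toCl g))) :=
      (hs.continuousOn.continuousAt hU).tendsto.comp continuous_toCl.continuousAt
    refine hsg.congr' ?_
    filter_upwards [hUg] with x hx
    exact (hy x hx).symm
  have hcΓ : ∀ x, toCl x ∈ U → eta n (y x * (f' * x)⁻¹) ∈ Γ := by
    intro x hx
    have h := hcov x
    rw [hΦy x hx] at h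
    obtain ⟨γ, hγ, h⟩ := orbitMk_eq_iff.1 (show orbitMk Γ (eta n (y x)) = _ from h)
    rw [map_mul, map_inv, h, smul_eq_mul, mul_inv_cancel_right]
    exact hγ
  have hct : Filter.Tendsto (fun x => y x * (f' * x)⁻¹) (𝓝 g) (𝓝 (y g * (f' * g)⁻¹)) :=
    hyg.mul ((continuous_inv.comp (continuous_const_mul f')).tendsto g)
  have hcg := hcΓ g (mem_of_mem_nhds hU)
  obtain ⟨γ', hγ', hγ⟩ := hmap.ge hcg
  -- The deviation of `y` from `f'` at `g` has the same image in `Γ` as `γ'`, so dividing by `γ'`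
  -- leaves a kernel element.
  refine ⟨γ'⁻¹ * (y g * (f' * g)⁻¹), by rw [map_mul, map_inv, hγ, inv_mul_cancel], ?_⟩
  filter_upwards [hUg, hct.eventually (eventually_eq_of_eta_mem Γ hcg)] with x hx hcx
  rw [hΦy x hx, orbitMk_eq_iff]
  refine ⟨γ', hγ', ?_⟩
  rw [← hcx (hcΓ x hx), smul_eq_mul]
  group

/-- A smooth map covering left multiplication by `f = η(f')` is left multiplication by `k f'` for
some `k` in the kernel of `η`. -/
theorem IsSmooth.exists_forall_eq {n : ℕ} {Γ : Subgroup (SOPlus n)} [DiscreteTopology Γ]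
    {Γ' : Subgroup (SpinPlus n)} (hmap : Γ'.map (eta n) = Γ) (hinj : Set.InjOn (eta n) Γ')
    {f' : SpinPlus n} {Φ : OrbitSpace Γ' (SpinPlus n) → OrbitSpace Γ' (SpinPlus n)}
    (hΦ : IsSmooth Γ' Φ)
    (hcov : ∀ x, spinStructure Γ Γ' hmap (Φ (orbitMk Γ' x)) = orbitMk Γ (eta n (f' * x))) :
    ∃ k, eta n k = 1 ∧ ∀ x, Φ (orbitMk Γ' x) = orbitMk Γ' (k * f' * x) := by
  choose κ hκ hκΦ using hΦ.eventually_eq hmap hcov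
  have hconst : IsLocallyConstant κ := by
    rw [IsLocallyConstant.iff_eventually_eq]
    intro g
    filter_upwards [hκΦ g] with x hx
    -- The two local descriptions of `Φ` at `x` differ by some `γ` in `Γ'`, which lies in the kernel
    -- of `η` and hence is trivial.
    obtain ⟨γ, hγ, h⟩ := orbitMk_eq_iff.1 ((hκΦ x).self_of_nhds.symm.trans hx)
    rw [smul_eq_mul, ← mul_assoc, ← mul_assoc] at h
    have h' : κ x = γ * κ g := mul_right_cancel (mul_right_cancel h)
    have hγ1 : γ = 1 := by
      refine hinj hγ (one_mem Γ') ?_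
      have h2 := congrArg (eta n) h'
      rwa [map_mul, hκ, hκ, mul_one, ← map_one (eta n), eq_comm] at h2
    rw [h', hγ1, one_mul]
  refine ⟨κ 1, hκ 1, fun x => ?_⟩
  rw [← hconst.apply_eq_of_preconnectedSpace x 1]
  exact (hκΦ x).self_of_nhds

/-- If `k f'` with `η(k) = 1` descends to `Γ'\Spin⁺(n,1)`, then `f'` normalizes `Γ'`. -/
theorem conjSubgroup_eq_of_forall_orbitMk_eq {n : ℕ} {Γ : Subgroup (SOPlus n)}
    {Γ' : Subgroup (SpinPlus n)} (hmap : Γ'.map (eta n) = Γ) (hinj : Set.InjOn (eta n) Γ')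
    {f' k : SpinPlus n} (hf : conjSubgroup (eta n f') Γ = Γ) (hk : eta n k = 1)
    (h : ∀ γ ∈ Γ', orbitMk Γ' (k * f' * γ) = orbitMk Γ' (k * f')) :
    conjSubgroup f' Γ' = Γ' := by
  have hconj : ∀ γ ∈ Γ', f' * γ * f'⁻¹ ∈ Γ' := by
    intro γ hγ
    obtain ⟨δ, hδ, hδγ⟩ := orbitMk_eq_iff.1 (h γ hγ)
    -- Centrality of `k` moves it to the right end of both sides, where it cancels to leave `f' * γ
    -- = δ * f'`.
    rw [smul_eq_mul, mul_assoc k, commute_of_eta_eq_one hk, commute_of_eta_eq_one hk, ← mul_assoc]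
      at hδγ
    rw [mul_right_cancel hδγ, mul_inv_cancel_right]
    exact hδ
  refine le_antisymm ?_ fun γ hγ => ?_
  · rintro _ ⟨γ, hγ, rfl⟩
    exact hconj γ hγ
  -- For the reverse inclusion, write `η(γ)` as a conjugate inside `Γ` and lift it to `Γ'`; both
  -- candidates lie in `Γ'`, where `η` is injective.
  · obtain ⟨β, hβ, hβγ⟩ := hf.ge (show eta n γ ∈ Γ from hmap.le ⟨γ, hγ, rfl⟩)
    obtain ⟨δ, hδ, rfl⟩ := hmap.ge hβ
    refine ⟨δ, hδ, hinj (hconj δ hδ) hγ ?_⟩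
    rw [← hβγ, map_mul, map_mul, map_inv]
    rfl

end HypSpin

theorem theorem2p2 (n : ℕ) (hn : 2 ≤ n)
    (Γ : Subgroup (HypSpin.SOPlus n)) (hdisc : DiscreteTopology Γ)
    (htf : ∀ γ ∈ Γ, IsOfFinOrder γ → γ = 1)
    (φ : HypSpin.OrbitSpace Γ (HypSpin.HSpace n) → HypSpin.OrbitSpace Γ (HypSpin.HSpace n))
    (f : HypSpin.SOPlus n) (hf : HypSpin.conjSubgroup f Γ = Γ)
    (hφ : φ = HypSpin.inducedMap Γ (HypSpin.HSpace n) f hf)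
    (Γ' : Subgroup (HypSpin.SpinPlus n)) (hmap : Γ'.map (HypSpin.eta n) = Γ)
    (hinj : Set.InjOn (HypSpin.eta n) Γ')
    (f' : HypSpin.SpinPlus n) (hf' : HypSpin.eta n f' = f) :
    HypSpin.LiftsToSpinStructure Γ Γ' hmap φ ↔ HypSpin.conjSubgroup f' Γ' = Γ' := by
  open HypSpin in
  subst hf'
  constructor
  · rintro ⟨Ψ, ⟨g, hg, hφg, rfl⟩, Φ, ⟨hΦ, -⟩, hΦΨ⟩
    -- The frame map may be given by another representative `g`, but `g = γf` with `γ` in `Γ`, so it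
    -- induces the same map on `Γ\SO⁺(n,1)`.
    obtain ⟨γ, hγ, rfl⟩ := exists_mul_eq_of_inducedMap_eq (hφg.symm.trans hφ)
    obtain ⟨k, hk, hkΦ⟩ := hΦ.exists_forall_eq hmap hinj (f' := f') fun x => by
      refine (congrFun hΦΨ (orbitMk Γ' x)).trans (orbitMk_eq_iff.2 ⟨γ, hγ, ?_⟩)
      rw [map_mul, smul_eq_mul, smul_eq_mul, mul_assoc]
    refine conjSubgroup_eq_of_forall_orbitMk_eq hmap hinj hf hk fun γ hγ => ?_
    -- Well-definedness of `Φ` on the single coset `Γ'` already gives the normalizing condition.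
    have h1 : orbitMk Γ' γ = orbitMk Γ' 1 :=
      orbitMk_eq_iff.2 ⟨γ, hγ, (mul_one γ).symm⟩
    rw [← hkΦ γ, h1, hkΦ 1, mul_one]
  · intro h
    refine ⟨_, ⟨_, hf, hφ, rfl⟩, inducedMap Γ' (SpinPlus n) f' h, isDiffeo_inducedMap Γ' f' h, ?_⟩
    funext x
    induction x using Quotient.inductionOn with
    | h x =>
      change orbitMk Γ (eta n (f' * x)) = orbitMk Γ (eta n f' * eta n x)
      rw [map_mul]
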